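/- A Reeb graph $(X,f)$ is a finite graph $X$, viewed as a topological space that is a finite regular CW complex of dimension at most one (it may be empty or disconnected), together with a continuous function $f:X\to\mathbb{R}$ that is monotone (not necessarily strictly) on every edge. A map of spaces with real-valued functions $(X,f)\to(Y,g)$ is called function preserving if it is a continuous map $\phi:X\to Y$ with $g\circ\phi=f$. Smoothing. For a topological space $X$ with a continuous function $f:X\to\mathbb{R}$ and $\varepsilon\ge 0$, the smoothing $T_\varepsilon(X,f)$ is the quotient space of $X\times[-\varepsilon,\varepsilon]$ that identifies two points if they lie in the same path component of a level set of $(x,t)\mapsto f(x)+t$, together with the function induced by $(x,t)\mapsto f(x)+t$. Let $\iota:(X,f)\to T_\varepsilon(X,f)$ be the map $x\mapsto[x,0]$. A function-preserving map $\phi:(X,f)\to(Z,h)$ induces a function-preserving map $T_\varepsilon[\phi]:T_\varepsilon(X,f)\to T_\varepsilon(Z,h)$, $[x,t]\mapsto[\phi(x),t]$. Interleaving distance. An $\varepsilon$-interleaving of $(X,f)$ and $(Y,g)$ is a pair of function-preserving maps $\phi:(X,f)\to T_\varepsilon(Y,g)$ and $\psi:(Y,g)\to T_\varepsilon(X,f)$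 such that $$T_\varepsilon[\psi]\circ\phi=\iota_\varepsilon\circ\iota:(X,f)\to T_\varepsilon(T_\varepsilon(X,f)),\qquad T_\varepsilon[\phi]\circ\psi=\iota_\varepsilon\circ\iota:(Y,g)\to T_\varepsilon(T_\varepsilon(Y,g)),$$ where $\iota_\varepsilon$ denotes the natural map $\iota$ of the smoothed space (for Reeb graphs, $T_\varepsilon(T_\varepsilon(X,f))\cong T_{2\varepsilon}(X,f)$). The interleaving distance is $$d_I(f,g)=\inf\{\varepsilon\ge 0\mid\text{there is an }\varepsilon\text{-interleaving of }(X,f)\text{ and }(Y,g)\}\in[0,\infty].$$ Functional distortion distance. For $x,x'\in X$ let $d_f(x,x')\in[0,\infty]$ be the infimum of $\max_\pi f-\min_\pi f$ over all paths $\pi$ in $X$ from $x$ to $x'$ ($\infty$ if there is none); define $d_g$ in the same way. For continuous maps $\phi:X\to Y$ and $\psi:Y\to X$ (not required to preserve function values), let $C(\phi,\psi)=\{(x,y)\in X\times Y\mid \phi(x)=y\text{ or }x=\psi(y)\}$ and $$D(\phi,\psi)=\sup_{(x,y),(x',y')\in C(\phi,\psi)}\tfrac12\,|d_f(x,x')-d_g(y,y')|\in[0,\infty],$$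 where $|\infty-\infty|=0$. The functional distortion distance is $$d_{FD}(f,g)=\inf_{\phi,\psi}\max\{D(\phi,\psi),\ \|f-g\circ\phi\|_\infty,\ \|g-f\circ\psi\|_\infty\}\in[0,\infty],$$ the infimum being over all pairs of continuous maps $\phi:X\to Y$, $\psi:Y\to X$. (Suprema of the empty set are $0$ and infima of the empty set are $\infty$.) **Theorem.** For any two Reeb graphs $(X,f)$ and $(Y,g)$, $$d_I(f,g)\le d_{FD}(f,g)\le 7\,d_I(f,g).$$ In particular, the interleaving distance and the functional distortion distance are strongly equivalent. -/

import Mathlib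

universe u v w

namespace ReebDist

open Set Metric Topology
open scoped NNReal ENNReal unitInterval

/-! ### Reeb graphs -/

/-- An object of the category of Reeb graphs: a finite graph, viewed as a finite regular
CW complex of dimension at most one, with a continuous real-valued function that is monotone on
every edge. Mathlib's characteristic maps are defined on the unit ball of `Fin n → ℝ` (sup norm),
so the closed edge `e` is parametrized by `t ↦ map 1 e (fun _ ↦ t)`, `t ∈ [-1, 1]`. -/
structure ReebGraph : Type (u + 1) where
  /-- the underlying space -/
  carrier : Type u
  [top : TopologicalSpace carrier]
  [t2 : T2Space carrier]
  [cw : CWComplex (univ : Set carrier)]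
  finite : CWComplex.Finite (univ : Set carrier)
  dim_le_one : ∀ n : ℕ, 2 ≤ n → IsEmpty (RelCWComplex.cell (univ : Set carrier) n)
  /-- regularity: every characteristic map is injective on the closed ball -/
  regular : ∀ (n : ℕ) (i : RelCWComplex.cell (univ : Set carrier) n),
    InjOn (RelCWComplex.map (C := (univ : Set carrier)) n i) (closedBall 0 1)
  /-- the real-valued function -/
  f : C(carrier, ℝ)
  monotone_on_edges : ∀ e : RelCWComplex.cell (univ : Set carrier) 1,
    MonotoneOn (fun t : ℝ ↦ f (RelCWComplex.map (C := (univ : Set carrier)) 1 e fun _ ↦ t))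
        (Icc (-1) 1) ∨
      AntitoneOn (fun t : ℝ ↦ f (RelCWComplex.map (C := (univ : Set carrier)) 1 e fun _ ↦ t))
        (Icc (-1) 1)

attribute [instance] ReebGraph.top ReebGraph.t2 ReebGraph.cw

/-! ### Function-preserving maps -/

/-- A continuous map `X → Y` that preserves function values: `g (φ x) = f x`. -/
@[ext]
structure FunMap {X : Type u} {Y : Type v} [TopologicalSpace X] [TopologicalSpace Y]
    (f : C(X, ℝ)) (g : C(Y, ℝ)) where
  toMap : C(X, Y)
  comm : ∀ x, g (toMap x) = f x

/-- Composition of function-preserving maps. -/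
def FunMap.comp {X : Type u} {Y : Type v} {Z : Type w} [TopologicalSpace X] [TopologicalSpace Y]
    [TopologicalSpace Z] {f : C(X, ℝ)} {g : C(Y, ℝ)} {h : C(Z, ℝ)}
    (ψ : FunMap g h) (φ : FunMap f g) : FunMap f h where
  toMap := ψ.toMap.comp φ.toMap
  comm x := by simp [ψ.comm, φ.comm]

/-! ### The Reeb quotient of a space with a function -/

/-- `x ∼ y` iff `x` and `y` lie in the same path component of a level set of `f`. -/
def reebSetoid {X : Type u} [TopologicalSpace X] (f : C(X, ℝ)) : Setoid X where
  r x y := ∃ a : ℝ, JoinedIn (f ⁻¹' {a}) x y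
  iseqv :=
    { refl := fun x ↦ ⟨f x, JoinedIn.refl rfl⟩
      symm := fun ⟨a, h⟩ ↦ ⟨a, h.symm⟩
      trans := by
        rintro x y z ⟨a, h⟩ ⟨b, k⟩
        have hab : a = b := by
          have h1 : f y = a := h.target_mem
          have h2 : f y = b := k.source_mem
          exact h1.symm.trans h2
        subst hab
        exact ⟨a, h.trans k⟩ }

/-- The quotient space `X / ∼_f`, with the quotient topology. -/
def ReebQuot {X : Type u} [TopologicalSpace X] (f : C(X, ℝ)) : Type u :=
  Quotient (reebSetoid f)

instance {X : Type u} [TopologicalSpace X] (f : C(X, ℝ)) : TopologicalSpace (ReebQuot f) :=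
  inferInstanceAs (TopologicalSpace (Quotient (reebSetoid f)))

/-- The quotient map `X → X / ∼_f`. -/
def reebMk {X : Type u} [TopologicalSpace X] (f : C(X, ℝ)) : C(X, ReebQuot f) where
  toFun := Quotient.mk (reebSetoid f)
  continuous_toFun := continuous_quot_mk

/-- The function that `X / ∼_f` inherits from `f`. -/
def reebFun {X : Type u} [TopologicalSpace X] (f : C(X, ℝ)) : C(ReebQuot f, ℝ) where
  toFun := Quotient.lift f (by
    rintro x y ⟨a, h⟩
    have h1 : f x = a := h.source_mem
    have h2 : f y = a := h.target_mem
    exact h1.trans h2.symm)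
  continuous_toFun := f.continuous.quotient_lift _

/-- A function-preserving map induces a function-preserving map of Reeb quotients,
`[x] ↦ [φ x]`. -/
def FunMap.quot {X : Type u} {Y : Type v} [TopologicalSpace X] [TopologicalSpace Y]
    {f : C(X, ℝ)} {g : C(Y, ℝ)} (φ : FunMap f g) : FunMap (reebFun f) (reebFun g) where
  toMap :=
    { toFun := Quotient.map φ.toMap (by
        rintro x y ⟨a, γ, hγ⟩
        refine ⟨a, γ.map φ.toMap.continuous, fun t ↦ ?_⟩
        have h : f (γ t) = a := hγ t
        have h' : g (φ.toMap (γ t)) = a := (φ.comm _).trans h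
        exact h')
      continuous_toFun := φ.toMap.continuous.quotient_map' _ }
  comm := by
    rintro ⟨x⟩
    exact φ.comm x

/-! ### Smoothing -/

/-- The function `f_ε (x, t) = f x + t` on `X_ε = X × [-ε, ε]`. -/
def thickFun {X : Type u} [TopologicalSpace X] (f : C(X, ℝ)) (ε : ℝ≥0) :
    C(X × Icc (-(ε : ℝ)) (ε : ℝ), ℝ) where
  toFun p := f p.1 + (p.2 : ℝ)
  continuous_toFun := by fun_prop

/-- The underlying space of the `ε`-smoothing `T_ε(X, f)`: the Reeb quotient of `(X_ε, f_ε)`. -/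
abbrev Smoothing {X : Type u} [TopologicalSpace X] (f : C(X, ℝ)) (ε : ℝ≥0) : Type u :=
  ReebQuot (thickFun f ε)

/-- The function of the `ε`-smoothing `T_ε(X, f)`. -/
abbrev smoothFun {X : Type u} [TopologicalSpace X] (f : C(X, ℝ)) (ε : ℝ≥0) :
    C(Smoothing f ε, ℝ) :=
  reebFun (thickFun f ε)

/-- The natural map `ι : (X, f) → T_ε(X, f)`, `x ↦ [x, 0]`. -/
def smoothIncl {X : Type u} [TopologicalSpace X] (f : C(X, ℝ)) (ε : ℝ≥0) :
    FunMap f (smoothFun f ε) where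
  toMap := (reebMk (thickFun f ε)).comp
    { toFun := fun x ↦ (x, ⟨0, by simp⟩)
      continuous_toFun := by fun_prop }
  comm x := add_zero (f x)

/-- `φ × id : X_ε → Y_ε`. -/
def FunMap.thick {X : Type u} {Y : Type v} [TopologicalSpace X] [TopologicalSpace Y]
    {f : C(X, ℝ)} {g : C(Y, ℝ)} (φ : FunMap f g) (ε : ℝ≥0) :
    FunMap (thickFun f ε) (thickFun g ε) where
  toMap := φ.toMap.prodMap (ContinuousMap.id _)
  comm p := congrArg (· + (p.2 : ℝ)) (φ.comm p.1)

/-- The map `T_ε(X, f) → T_ε(Y, g)`, `[x, t] ↦ [φ x, t]`, induced by `φ : (X, f) → (Y, g)`. -/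
def FunMap.smooth {X : Type u} {Y : Type v} [TopologicalSpace X] [TopologicalSpace Y]
    {f : C(X, ℝ)} {g : C(Y, ℝ)} (φ : FunMap f g) (ε : ℝ≥0) :
    FunMap (smoothFun f ε) (smoothFun g ε) :=
  (φ.thick ε).quot

/-- The parallelograms of the interleaving diagram always commute: `φ_ε ∘ ι = ι_ε ∘ φ`. -/
theorem FunMap.smooth_comp_smoothIncl {X : Type u} {Y : Type v} [TopologicalSpace X]
    [TopologicalSpace Y] {f : C(X, ℝ)} {g : C(Y, ℝ)} (φ : FunMap f g) (ε : ℝ≥0) :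
    (φ.smooth ε).comp (smoothIncl f ε) = (smoothIncl g ε).comp φ :=
  rfl

/-! ### The interleaving distance -/

/-- `φ : (X, f) → T_ε(Y, g)` and `ψ : (Y, g) → T_ε(X, f)` form an `ε`-interleaving: with
`φ_ε = T_ε[φ]` and `ψ_ε = T_ε[ψ]` one has `ψ_ε ∘ φ = ι_ε ∘ ι` and `φ_ε ∘ ψ = ι_ε ∘ ι`.
The double smoothing `T_ε(T_ε(X, f))` plays the role of `T_{2ε}(X, f)`. -/
def IsInterleaving {X : Type u} {Y : Type v} [TopologicalSpace X] [TopologicalSpace Y]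
    {f : C(X, ℝ)} {g : C(Y, ℝ)} {ε : ℝ≥0}
    (φ : FunMap f (smoothFun g ε)) (ψ : FunMap g (smoothFun f ε)) : Prop :=
  (ψ.smooth ε).comp φ = (smoothIncl (smoothFun f ε) ε).comp (smoothIncl f ε) ∧
  (φ.smooth ε).comp ψ = (smoothIncl (smoothFun g ε) ε).comp (smoothIncl g ε)

/-- The interleaving distance `d_I(f, g)`, with values in `[0, ∞]`. -/
noncomputable def interleavingDist {X : Type u} {Y : Type v} [TopologicalSpace X]
    [TopologicalSpace Y] (f : C(X, ℝ)) (g : C(Y, ℝ)) : ℝ≥0∞ :=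
  ⨅ (ε : ℝ≥0) (_ : ∃ (φ : FunMap f (smoothFun g ε)) (ψ : FunMap g (smoothFun f ε)),
    IsInterleaving φ ψ), (ε : ℝ≥0∞)

/-! ### The functional distortion distance -/

/-- The height `max f - min f` of a path (both extrema are attained since `[0, 1]` is compact). -/
noncomputable def height {X : Type u} [TopologicalSpace X] (f : C(X, ℝ)) {x y : X}
    (γ : Path x y) : ℝ :=
  (⨆ s : I, f (γ s)) - ⨅ s : I, f (γ s)

/-- `d_f(x, y)`: the infimum of the heights of the paths from `x` to `y`;
it is `∞` if there is no path. -/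
noncomputable def pathDist {X : Type u} [TopologicalSpace X] (f : C(X, ℝ)) (x y : X) : ℝ≥0∞ :=
  ⨅ γ : Path x y, ENNReal.ofReal (height f γ)

/-- `|a - b|` for `a, b ∈ [0, ∞]`, with `|∞ - ∞| = 0`. -/
noncomputable def absDiff (a b : ℝ≥0∞) : ℝ≥0∞ := max (a - b) (b - a)

/-- `C(φ, ψ) = {(x, y) | φ x = y or x = ψ y}`. -/
def corr {X : Type u} {Y : Type v} [TopologicalSpace X] [TopologicalSpace Y]
    (φ : C(X, Y)) (ψ : C(Y, X)) : Set (X × Y) :=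
  {p | φ p.1 = p.2 ∨ p.1 = ψ p.2}

/-- The distortion `D(φ, ψ) = sup (1/2) |d_f(x, x') - d_g(y, y')|` over
`(x, y), (x', y') ∈ C(φ, ψ)`. -/
noncomputable def distortion {X : Type u} {Y : Type v} [TopologicalSpace X] [TopologicalSpace Y]
    (f : C(X, ℝ)) (g : C(Y, ℝ)) (φ : C(X, Y)) (ψ : C(Y, X)) : ℝ≥0∞ :=
  ⨆ p ∈ corr φ ψ, ⨆ q ∈ corr φ ψ, absDiff (pathDist f p.1 q.1) (pathDist g p.2 q.2) / 2

/-- The supremum norm `‖f - h‖_∞`, with values in `[0, ∞]`. -/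
noncomputable def supDist {X : Type u} [TopologicalSpace X] (f h : C(X, ℝ)) : ℝ≥0∞ :=
  ⨆ x, ENNReal.ofReal |f x - h x|

/-- The functional distortion distance `d_FD(f, g)`, with values in `[0, ∞]`; the infimum is over
all pairs of continuous maps `φ : X → Y`, `ψ : Y → X`. -/
noncomputable def functionalDistortionDist {X : Type u} {Y : Type v} [TopologicalSpace X]
    [TopologicalSpace Y] (f : C(X, ℝ)) (g : C(Y, ℝ)) : ℝ≥0∞ :=
  ⨅ (φ : C(X, Y)) (ψ : C(Y, X)),
    max (distortion f g φ ψ) (max (supDist f (g.comp φ)) (supDist g (f.comp ψ)))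

end ReebDist

/-!
Both inequalities hold because path distances survive the passage to a smoothing up to a controlled
loss.

For `d_I ≤ d_FD`, continuous maps `φ : X → Y` and `ψ : Y → X` that move function values by at most
`ε` become function-preserving maps into the smoothings by correcting the value,
`x ↦ [φ x, f x - g (φ x)]`. Since `(x, φ x)` and `(ψ (φ x), φ x)` both lie in `C(φ, ψ)`, a distortion
below `ε` yields a path from `x` to `ψ (φ x)` of height less than `2 ε`. In the double smoothing the
deviation of `f` along that path can be compensated by the two shifts, so that the two points become
equal (`reebMk_reebMk_eq`). This part holds for arbitrary spaces.

For the other inequality, the main point is that the Reeb quotient `Z → Z / ∼_h` of a locally path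
connected space preserves path distances (`pathDist_le_pathDist_reebMk`): the path components of
`h⁻¹(U)`, for `U` open, are open and saturated, so their images are disjoint open sets, and a
connected set in the quotient cannot pass from one to another (`joinedIn_of_isPreconnected`). Hence
points of `X` are at most `2 ε` farther apart than their classes in `T_ε(X, f)`. The same fact allows
paths in the quotient to be lifted approximately with prescribed endpoints
(`exists_approx_lift_path`), and doing so edge by edge gives approximate lifts of continuous maps
from a finite graph (`ReebGraph.exists_approx_lift`). Applied to the maps `X → T_ε(Y, g)` and
`Y → T_ε(X, f)` of an interleaving, this provides continuous maps `Φ : X → Y` and `Ψ : Y → X` that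
increase path distances by at most `2 ε` and satisfy `d_f(x, Ψ (Φ x)) ≤ 4 ε`, always up to the
arbitrarily small lifting error. Comparing `x` with `Ψ y` for `(x, y) ∈ C(Φ, Ψ)` bounds
`|d_f - d_g|` by `10 ε`, hence the distortion by `5 ε`, which is better than the required `7 ε`.
-/

namespace ReebDist

open Set Metric Topology
open scoped NNReal ENNReal unitInterval

/-! ### Heights of paths and the path distance -/

section PathDist

variable {X : Type u} {Y : Type v} [TopologicalSpace X] [TopologicalSpace Y]
  {f : C(X, ℝ)} {g : C(Y, ℝ)} {x y : X}

theorem height_le {γ : Path x y} {a b : ℝ} (h : ∀ s, f (γ s) ∈ Icc a b) :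
    height f γ ≤ b - a :=
  sub_le_sub (ciSup_le fun s ↦ (h s).2) (le_ciInf fun s ↦ (h s).1)

theorem apply_path_mem_Icc (f : C(X, ℝ)) (γ : Path x y) (s : I) :
    f (γ s) ∈ Icc (⨅ s : I, f (γ s)) (⨆ s : I, f (γ s)) := by
  have hc : Continuous fun s : I ↦ f (γ s) := by fun_prop
  exact ⟨ciInf_le (isCompact_range hc).bddBelow s, le_ciSup (isCompact_range hc).bddAbove s⟩

theorem height_nonneg (f : C(X, ℝ)) (γ : Path x y) : 0 ≤ height f γ := by
  have h := apply_path_mem_Icc f γ 0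
  exact sub_nonneg.2 (h.1.trans h.2)

theorem pathDist_le_of_joinedIn {a b : ℝ} (h : JoinedIn (f ⁻¹' Icc a b) x y) :
    pathDist f x y ≤ ENNReal.ofReal (b - a) := by
  obtain ⟨γ, hγ⟩ := h
  exact iInf_le_of_le γ (ENNReal.ofReal_le_ofReal (height_le hγ))

theorem exists_joinedIn_of_pathDist_lt {r : ℝ≥0} (h : pathDist f x y < r) :
    ∃ a b : ℝ, b - a < r ∧ JoinedIn (f ⁻¹' Icc a b) x y := by
  obtain ⟨γ, hγ⟩ := iInf_lt_iff.1 h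
  rw [← ENNReal.ofReal_coe_nnreal, ENNReal.ofReal_lt_ofReal_iff_of_nonneg (height_nonneg f γ)] at hγ
  exact ⟨_, _, hγ, γ, apply_path_mem_Icc f γ⟩

@[simp]
theorem pathDist_self (f : C(X, ℝ)) (x : X) : pathDist f x x = 0 := by
  have h : JoinedIn (f ⁻¹' Icc (f x) (f x)) x x := JoinedIn.refl (by simp)
  simpa using pathDist_le_of_joinedIn h

theorem pathDist_comm (f : C(X, ℝ)) (x y : X) : pathDist f x y = pathDist f y x := by
  have key : ∀ x y : X, pathDist f x y ≤ pathDist f y x := fun x y ↦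
    le_iInf fun γ ↦ iInf_le_of_le γ.symm <| ENNReal.ofReal_le_ofReal <|
      height_le fun s ↦ apply_path_mem_Icc f γ (σ s)
  exact le_antisymm (key x y) (key y x)

theorem pathDist_triangle (f : C(X, ℝ)) (x y z : X) :
    pathDist f x z ≤ pathDist f x y + pathDist f y z := by
  simp only [pathDist, ENNReal.iInf_add, ENNReal.add_iInf]
  refine le_iInf₂ fun γ' γ ↦ ?_
  rw [← ENNReal.ofReal_add (height_nonneg _ _) (height_nonneg _ _)]
  refine iInf_le_of_le (γ.trans γ') (ENNReal.ofReal_le_ofReal ?_)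
  have h1 := apply_path_mem_Icc f γ 1
  have h2 := apply_path_mem_Icc f γ' 0
  rw [γ.target] at h1
  rw [γ'.source] at h2
  have h : ∀ s, f ((γ.trans γ') s) ∈
      Icc (min (⨅ s : I, f (γ s)) (⨅ s : I, f (γ' s)))
        (max (⨆ s : I, f (γ s)) (⨆ s : I, f (γ' s))) := fun s ↦ by
    have hs : (γ.trans γ') s ∈ range γ ∪ range γ' := by
      rw [← Path.trans_range]
      exact mem_range_self s
    obtain ⟨t, ht⟩ | ⟨t, ht⟩ := hs
    · have := apply_path_mem_Icc f γ t
      rw [← ht]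
      exact ⟨min_le_of_left_le this.1, le_max_of_le_left this.2⟩
    · have := apply_path_mem_Icc f γ' t
      rw [← ht]
      exact ⟨min_le_of_right_le this.1, le_max_of_le_right this.2⟩
  -- both ranges contain `f y`, so their union is an interval of at most the total length
  refine (height_le h).trans ?_
  simp only [height]
  rcases max_cases (⨆ s : I, f (γ s)) (⨆ s : I, f (γ' s)) with h | h <;>
  rcases min_cases (⨅ s : I, f (γ s)) (⨅ s : I, f (γ' s)) with h' | h' <;>
  linarith [h1.1, h1.2, h2.1, h2.2]

/-- A continuous map that lowers values by at most `a` and raises them by at most `b` increases the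
path distance by at most `a + b`. Either bound may be negative, so that shifts are covered. -/
theorem pathDist_map_le (k : C(X, Y)) {a b : ℝ} (hk : ∀ x, g (k x) ∈ Icc (f x - a) (f x + b)) :
    pathDist g (k x) (k y) ≤ pathDist f x y + ENNReal.ofReal (a + b) := by
  simp only [pathDist, ENNReal.iInf_add]
  refine le_iInf fun γ ↦ iInf_le_of_le (γ.map k.continuous) ?_
  refine (ENNReal.ofReal_le_ofReal ?_).trans ENNReal.ofReal_add_le
  refine (height_le (a := (⨅ s : I, f (γ s)) - a) (b := (⨆ s : I, f (γ s)) + b) fun s ↦ ?_).trans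
    (by simp only [height]; linarith)
  have h1 := apply_path_mem_Icc f γ s
  have h2 := hk (γ s)
  simp only [Path.map_coe, Function.comp_apply]
  constructor <;> linarith [h1.1, h1.2, h2.1, h2.2]

theorem FunMap.pathDist_le (φ : FunMap f g) :
    pathDist g (φ.toMap x) (φ.toMap y) ≤ pathDist f x y := by
  simpa using pathDist_map_le (f := f) (g := g) (x := x) (y := y) φ.toMap (a := 0) (b := 0)
    fun x ↦ by simp [φ.comm]

theorem ofReal_abs_sub_le_pathDist (f : C(X, ℝ)) (x y : X) :
    ENNReal.ofReal |f x - f y| ≤ pathDist f x y := by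
  refine le_iInf fun γ ↦ ENNReal.ofReal_le_ofReal ?_
  have h1 := apply_path_mem_Icc f γ 0
  have h2 := apply_path_mem_Icc f γ 1
  rw [γ.source] at h1
  rw [γ.target] at h2
  simp only [height]
  rw [abs_le]
  constructor <;> linarith [h1.1, h1.2, h2.1, h2.2]

end PathDist

/-! ### Lifting through the Reeb quotient -/

section Lifting

variable {Z : Type u} [TopologicalSpace Z] {h : C(Z, ℝ)}

theorem isQuotientMap_reebMk (h : C(Z, ℝ)) : IsQuotientMap (reebMk h) :=
  isQuotientMap_quot_mk

instance [LocallyPathConnectedSpace Z] : LocallyPathConnectedSpace (ReebQuot h) :=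
  (isQuotientMap_reebMk h).locallyPathConnectedSpace

theorem reebMk_eq_iff {z z' : Z} :
    reebMk h z = reebMk h z' ↔ ∃ a : ℝ, JoinedIn (h ⁻¹' {a}) z z' :=
  Quotient.eq (r := reebSetoid h)

/-- If two points of a locally path connected space map to a preconnected set of the Reeb quotient
on which the function has values in an open set `U`, they are joined by a path on which the function
has values in `U`: the path components of the preimage of `U` are open and unions of fibres, hence
have disjoint open images. -/
theorem joinedIn_of_isPreconnected [LocallyPathConnectedSpace Z] {U : Set ℝ} (hU : IsOpen U)
    {S : Set (ReebQuot h)} (hS : IsPreconnected S) (hSU : S ⊆ reebFun h ⁻¹' U) {z z' : Z}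
    (hz : reebMk h z ∈ S) (hz' : reebMk h z' ∈ S) : JoinedIn (h ⁻¹' U) z z' := by
  have hO : IsOpen (h ⁻¹' U) := hU.preimage h.continuous
  have hsat : ∀ w w', w ∈ h ⁻¹' U → reebMk h w = reebMk h w' → JoinedIn (h ⁻¹' U) w w' := by
    intro w w' hw hww'
    obtain ⟨a, ha⟩ := reebMk_eq_iff.1 hww'
    have haw : h w = a := ha.source_mem
    exact ha.mono (preimage_mono (singleton_subset_iff.2 (haw ▸ hw)))
  set W : Set Z := pathComponentIn (h ⁻¹' U) z
  set V : Set Z := ⋃ w ∈ {w | w ∈ h ⁻¹' U ∧ w ∉ W}, pathComponentIn (h ⁻¹' U) w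
  have open_image : ∀ A : Set Z, IsOpen A → (∀ w ∈ A, ∀ w', JoinedIn (h ⁻¹' U) w w' → w' ∈ A) →
      A ⊆ h ⁻¹' U → IsOpen (reebMk h '' A) := by
    intro A hA hAs hAU
    rw [← (isQuotientMap_reebMk h).isOpen_preimage]
    convert hA using 1
    refine Subset.antisymm ?_ (subset_preimage_image _ _)
    rintro w' ⟨w, hw, hww'⟩
    exact hAs w hw w' (hsat w w' (hAU hw) hww')
  have hWo : IsOpen (reebMk h '' W) := open_image W (hO.pathComponentIn z)
    (fun w hw w' hww' ↦ JoinedIn.trans hw hww') pathComponentIn_subset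
  have hVo : IsOpen (reebMk h '' V) := by
    refine open_image V (isOpen_biUnion fun w _ ↦ hO.pathComponentIn w) ?_
      (iUnion₂_subset fun w _ ↦ pathComponentIn_subset)
    intro w hw w' hww'
    obtain ⟨v, hv, hvw⟩ := mem_iUnion₂.1 hw
    exact mem_iUnion₂.2 ⟨v, hv, JoinedIn.trans hvw hww'⟩
  have hdisj : Disjoint (reebMk h '' W) (reebMk h '' V) := by
    rw [Set.disjoint_left]
    rintro _ ⟨w, hw, rfl⟩ ⟨w', hw', hww'⟩
    obtain ⟨v, hv, hvw⟩ := mem_iUnion₂.1 hw'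
    have hvw : JoinedIn (h ⁻¹' U) v w' := hvw
    have h1 : JoinedIn (h ⁻¹' U) w' w := hsat w' w hvw.target_mem hww'
    exact hv.2 (JoinedIn.trans hw (hvw.trans h1).symm)
  have hzU : z ∈ h ⁻¹' U := hSU hz
  have hcov : S ⊆ reebMk h '' W ∪ reebMk h '' V := by
    intro p hp
    obtain ⟨w, rfl⟩ := (isQuotientMap_reebMk h).surjective p
    have hwU : w ∈ h ⁻¹' U := hSU hp
    by_cases hw : w ∈ W
    · exact Or.inl ⟨w, hw, rfl⟩
    · exact Or.inr ⟨w, mem_iUnion₂.2 ⟨w, ⟨hwU, hw⟩, mem_pathComponentIn_self hwU⟩, rfl⟩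
  have hsub := hS.subset_left_of_subset_union hWo hVo hdisj hcov
    ⟨_, hz, z, mem_pathComponentIn_self hzU, rfl⟩
  obtain ⟨w, hw, hwz'⟩ := hsub hz'
  have hw : JoinedIn (h ⁻¹' U) z w := hw
  exact hw.trans (hsat w z' hw.target_mem hwz')

/-- The Reeb quotient of a locally path connected space does not shrink path distances. -/
theorem pathDist_le_pathDist_reebMk [LocallyPathConnectedSpace Z] (h : C(Z, ℝ)) (z z' : Z) :
    pathDist h z z' ≤ pathDist (reebFun h) (reebMk h z) (reebMk h z') := by
  refine le_iInf fun γ ↦ ENNReal.le_of_forall_pos_le_add fun δ hδ _ ↦ ?_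
  have hδ' : (0 : ℝ) < δ := hδ
  have hj : JoinedIn (h ⁻¹' Ioo ((⨅ s : I, reebFun h (γ s)) - δ / 2)
      ((⨆ s : I, reebFun h (γ s)) + δ / 2)) z z' := by
    refine joinedIn_of_isPreconnected isOpen_Ioo (isPreconnected_range γ.continuous) ?_
      ⟨0, γ.source⟩ ⟨1, γ.target⟩
    rintro _ ⟨s, rfl⟩
    have := apply_path_mem_Icc (reebFun h) γ s
    exact ⟨by linarith [this.1], by linarith [this.2]⟩
  refine (pathDist_le_of_joinedIn (hj.mono (preimage_mono Ioo_subset_Icc_self))).trans ?_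
  rw [← ENNReal.ofReal_coe_nnreal, ← ENNReal.ofReal_add (height_nonneg _ _) hδ'.le]
  refine ENNReal.ofReal_le_ofReal ?_
  simp only [height]
  linarith

/-- A path in the Reeb quotient of a locally path connected space lifts, with prescribed endpoints,
up to an error `δ`: if the function varies little along the path, every path between the endpoints
that stays close to the same level will do, and halving the parameter interval reduces to that
case. -/
theorem exists_approx_lift_path [LocallyPathConnectedSpace Z] (h : C(Z, ℝ))
    {τ : ℝ → ReebQuot h} {c d : ℝ} (hτ : ContinuousOn τ (Icc c d)) (hcd : c < d) {δ : ℝ}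
    (hδ : 0 < δ) {z z' : Z} (hz : reebMk h z = τ c) (hz' : reebMk h z' = τ d) :
    ∃ P : ℝ → Z, Continuous P ∧ P c = z ∧ P d = z' ∧
      ∀ t ∈ Icc c d, pathDist (reebFun h) (reebMk h (P t)) (τ t) ≤ ENNReal.ofReal δ := by
  have huc : UniformContinuousOn (fun t ↦ reebFun h (τ t)) (Icc c d) :=
    isCompact_Icc.uniformContinuousOn_of_continuous
      ((reebFun h).continuous.comp_continuousOn hτ)
  obtain ⟨η, hη, hηδ⟩ := Metric.uniformContinuousOn_iff.1 huc (δ / 2) (by positivity)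
  have key : ∀ (n : ℕ) (a b : ℝ), c ≤ a → a < b → b ≤ d → b - a < 2 ^ n * η →
      ∀ z z' : Z, reebMk h z = τ a → reebMk h z' = τ b →
      ∃ P : ℝ → Z, Continuous P ∧ P a = z ∧ P b = z' ∧
        ∀ t ∈ Icc a b, pathDist (reebFun h) (reebMk h (P t)) (τ t) ≤ ENNReal.ofReal δ := by
    intro n
    induction n with
    | zero =>
      intro a b hca hab hbd hlt z z' hz hz'
      set m := reebFun h (τ a)
      have hcont : ContinuousOn τ (Icc a b) := hτ.mono (Icc_subset_Icc hca hbd)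
      have hlev : ∀ t ∈ Icc a b, reebFun h (τ t) ∈ Ioo (m - δ / 2) (m + δ / 2) := by
        intro t ht
        have := hηδ t ⟨hca.trans ht.1, ht.2.trans hbd⟩ a ⟨hca, hab.le.trans hbd⟩ (by
          rw [Real.dist_eq, abs_of_nonneg (by linarith [ht.1])]
          linarith [ht.2])
        rw [Real.dist_eq, abs_lt] at this
        constructor <;> linarith [this.1, this.2]
      have hj : JoinedIn (h ⁻¹' Ioo (m - δ / 2) (m + δ / 2)) z z' := by
        refine joinedIn_of_isPreconnected (S := τ '' Icc a b) isOpen_Ioo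
          (isPreconnected_Icc.image _ hcont) ?_
          ⟨a, left_mem_Icc.2 hab.le, hz.symm⟩ ⟨b, right_mem_Icc.2 hab.le, hz'.symm⟩
        rintro _ ⟨t, ht, rfl⟩
        exact hlev t ht
      obtain ⟨γ, hγ⟩ := hj
      have hba : b - a ≠ 0 := by linarith
      refine ⟨fun t ↦ γ.extend ((t - a) / (b - a)), by fun_prop, by simp, by simp [hba],
        fun t ht ↦ ?_⟩
      have h1 : JoinedIn (reebFun h ⁻¹' Icc (m - δ / 2) (m + δ / 2)) (τ t) (τ a) := by
        have hp : IsPathConnected (τ '' Icc a b) :=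
          ((convex_Icc a b).isPathConnected ⟨a, left_mem_Icc.2 hab.le⟩).image' hcont
        refine (hp.joinedIn _ ⟨t, ht, rfl⟩ _ ⟨a, left_mem_Icc.2 hab.le, rfl⟩).mono ?_
        rintro _ ⟨s, hs, rfl⟩
        exact Ioo_subset_Icc_self (hlev s hs)
      have h2 : JoinedIn (reebFun h ⁻¹' Icc (m - δ / 2) (m + δ / 2)) (τ a)
          (reebMk h (γ.extend ((t - a) / (b - a)))) := by
        have hp : IsPathConnected (range γ) := by
          have : PathConnectedSpace I := isPathConnected_iff_pathConnectedSpace.1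
            ((convex_Icc (0 : ℝ) 1).isPathConnected ⟨0, by simp⟩)
          exact isPathConnected_range γ.continuous
        have hmem : γ.extend ((t - a) / (b - a)) ∈ range γ := by
          rw [← γ.extend_range]
          exact mem_range_self _
        rw [← hz]
        refine ((hp.joinedIn _ ⟨0, γ.source⟩ _ hmem).map (reebMk h).continuous).mono ?_
        rintro _ ⟨_, ⟨s, rfl⟩, rfl⟩
        exact Ioo_subset_Icc_self (hγ s)
      refine (pathDist_le_of_joinedIn (h1.trans h2).symm).trans
        (ENNReal.ofReal_le_ofReal (by linarith))
    | succ n ih =>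
      intro a b hca hab hbd hlt z z' hz hz'
      set e := (a + b) / 2 with he
      obtain ⟨y, hy⟩ := (isQuotientMap_reebMk h).surjective (τ e)
      rw [pow_succ] at hlt
      obtain ⟨P, hP, hPa, hPe, hPτ⟩ := ih a e hca (by linarith) (by linarith) (by linarith)
        z y hz hy
      obtain ⟨Q, hQ, hQe, hQb, hQτ⟩ := ih e b (by linarith) (by linarith) hbd (by linarith)
        y z' hy hz'
      refine ⟨fun t ↦ if t ≤ e then P t else Q t,
        hP.if_le hQ continuous_id continuous_const (by rintro t rfl; rw [hPe, hQe]), ?_, ?_, ?_⟩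
      · simp only [if_pos (show a ≤ e by linarith), hPa]
      · simp only [if_neg (show ¬ b ≤ e by linarith), hQb]
      · intro t ht
        by_cases hte : t ≤ e
        · simp only [if_pos hte]
          exact hPτ t ⟨ht.1, hte⟩
        · simp only [if_neg hte]
          exact hQτ t ⟨(not_le.1 hte).le, ht.2⟩
  obtain ⟨n, hn⟩ := pow_unbounded_of_one_lt ((d - c) / η) (one_lt_two : (1 : ℝ) < 2)
  exact key n c d le_rfl hcd le_rfl ((div_lt_iff₀ hη).1 hn) z z' hz hz'

end Lifting

/-! ### Smoothings -/

section Smoothing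

variable {X : Type u} {Y : Type v} [TopologicalSpace X] [TopologicalSpace Y]
  {f : C(X, ℝ)} {g : C(Y, ℝ)} {ε : ℝ≥0}

instance (a b : ℝ) : LocallyPathConnectedSpace (Icc a b) :=
  (convex_Icc a b).locallyPathConnectedSpace

theorem pathDist_fst_le [LocallyPathConnectedSpace X] (f : C(X, ℝ))
    (p q : X × Icc (-(ε : ℝ)) (ε : ℝ)) :
    pathDist f p.1 q.1 ≤
      pathDist (smoothFun f ε) (reebMk (thickFun f ε) p) (reebMk (thickFun f ε) q) + 2 * ε := by
  have h := pathDist_map_le (f := thickFun f ε) (g := f) (x := p) (y := q) ContinuousMap.fst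
    (a := ε) (b := ε) fun r ↦ by
      have h1 := r.2.2.1
      have h2 := r.2.2.2
      change f r.1 ∈ Icc (f r.1 + (r.2 : ℝ) - ε) (f r.1 + (r.2 : ℝ) + ε)
      constructor <;> linarith
  refine h.trans (add_le_add (pathDist_le_pathDist_reebMk _ _ _) (le_of_eq ?_))
  rw [← two_mul, ENNReal.ofReal_mul zero_le_two, ENNReal.ofReal_coe_nnreal, ENNReal.ofReal_ofNat]

theorem pathDist_reebMk_prodMk_le (f : C(X, ℝ)) (t : Icc (-(ε : ℝ)) (ε : ℝ)) (x y : X) :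
    pathDist (smoothFun f ε) (reebMk (thickFun f ε) (x, t)) (reebMk (thickFun f ε) (y, t)) ≤
      pathDist f x y := by
  have h := pathDist_map_le (f := f) (g := smoothFun f ε) (x := x) (y := y)
    ((reebMk (thickFun f ε)).comp ⟨fun x ↦ (x, t), by fun_prop⟩) (a := -t) (b := t) fun r ↦ by
      change f r + (t : ℝ) ∈ _
      simp
  simpa using h

/-- Along a path from `x` to `x'` on which `f` deviates from `f x` by at most `2 * ε`, the
deviation can be compensated by two shifts of size at most `ε`. -/
theorem reebMk_reebMk_eq {x x' : X} (s t : Icc (-(ε : ℝ)) (ε : ℝ))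
    (h : JoinedIn (f ⁻¹' Icc (f x - 2 * ε) (f x + 2 * ε)) x x')
    (hst : f x' + s + t = f x) :
    reebMk (thickFun (smoothFun f ε) ε) (reebMk (thickFun f ε) (x', s), t) =
      (smoothIncl (smoothFun f ε) ε).toMap ((smoothIncl f ε).toMap x) := by
  have hε : -(ε : ℝ) ≤ ε := by linarith [ε.coe_nonneg]
  let Q : X × Icc (-(ε : ℝ)) (ε : ℝ) → Smoothing f ε := reebMk (thickFun f ε)
  have hQ : Continuous Q := (reebMk (thickFun f ε)).continuous
  -- the deviation is first split evenly between the two shifts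
  let r : X → ℝ := fun y ↦ (f x - f y) / 2
  have hr : Continuous r := by fun_prop
  let K : X → Smoothing f ε × Icc (-(ε : ℝ)) (ε : ℝ) := fun y ↦
    (Q (y, projIcc _ _ hε (r y)), projIcc _ _ hε (r y))
  have hproj : Continuous fun y ↦ projIcc _ _ hε (r y) := continuous_projIcc.comp hr
  have hK : Continuous K := (hQ.comp (continuous_id.prodMk hproj)).prodMk hproj
  have h1 : JoinedIn (thickFun (smoothFun f ε) ε ⁻¹' {f x}) (K x) (K x') := by
    refine (h.map hK).mono ?_
    rintro _ ⟨y, hy, rfl⟩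
    have hy' : r y ∈ Icc (-(ε : ℝ)) ε := by
      have hy1 : f x - 2 * ε ≤ f y := hy.1
      have hy2 : f y ≤ f x + 2 * ε := hy.2
      constructor <;> simp only [r] <;> linarith
    change f y + (projIcc _ _ hε (r y) : ℝ) + (projIcc _ _ hε (r y) : ℝ) = f x
    rw [projIcc_of_mem _ hy']
    simp only [r]
    ring
  -- then the shifts are redistributed linearly, with constant sum
  let c : ℝ := f x - f x'
  let L : ℝ → Smoothing f ε × Icc (-(ε : ℝ)) (ε : ℝ) := fun τ ↦
    (Q (x', projIcc _ _ hε τ), projIcc _ _ hε (c - τ))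
  have hproj' : Continuous fun τ : ℝ ↦ projIcc _ _ hε (c - τ) :=
    continuous_projIcc.comp (by fun_prop)
  have hL : Continuous L :=
    (hQ.comp (continuous_const.prodMk continuous_projIcc)).prodMk hproj'
  have hx' : r x' ∈ Icc (-(ε : ℝ)) ε := by
    have hy1 : f x - 2 * ε ≤ f x' := h.target_mem.1
    have hy2 : f x' ≤ f x + 2 * ε := h.target_mem.2
    constructor <;> simp only [r] <;> linarith
  have hcr : c - r x' = r x' := by simp only [c, r]; ring
  have hcs : c - s = t := by simp only [c]; linarith
  have hmem1 : r x' ∈ Icc (max (-(ε : ℝ)) (c - ε)) (min (ε : ℝ) (c + ε)) :=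
    ⟨max_le hx'.1 (by linarith [hx'.2]), le_min hx'.2 (by linarith [hx'.1])⟩
  have hmem2 : (s : ℝ) ∈ Icc (max (-(ε : ℝ)) (c - ε)) (min (ε : ℝ) (c + ε)) :=
    ⟨max_le s.2.1 (by linarith [t.2.2]), le_min s.2.2 (by linarith [t.2.1])⟩
  have h2 : JoinedIn (thickFun (smoothFun f ε) ε ⁻¹' {f x}) (L (r x')) (L s) := by
    refine ((((convex_Icc _ _).isPathConnected ⟨_, hmem1⟩).joinedIn _ hmem1 _ hmem2).map hL).mono ?_
    rintro _ ⟨τ, hτ, rfl⟩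
    have hτ1 : τ ∈ Icc (-(ε : ℝ)) ε :=
      ⟨(le_max_left _ _).trans hτ.1, hτ.2.trans (min_le_left _ _)⟩
    have hτ2 : c - τ ∈ Icc (-(ε : ℝ)) ε :=
      ⟨by linarith [hτ.2.trans (min_le_right _ _)], by linarith [(le_max_right _ _).trans hτ.1]⟩
    change f x' + (projIcc _ _ hε τ : ℝ) + (projIcc _ _ hε (c - τ) : ℝ) = f x
    rw [projIcc_of_mem _ hτ1, projIcc_of_mem _ hτ2]
    simp only [c]
    ring
  have hKx : K x = ((smoothIncl f ε).toMap x, ⟨0, by simp⟩) := by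
    have h0 : projIcc _ _ hε (r x) = ⟨0, by simp⟩ := by
      simp only [r, sub_self, zero_div]
      exact projIcc_of_mem hε _
    simp only [K, h0]
    rfl
  have hKL : K x' = L (r x') := by
    simp only [K, L, hcr]
  have hLs : L s = (Q (x', s), t) := by
    simp only [L, hcs, projIcc_val]
  rw [hKL] at h1
  have h3 := (h1.trans h2).symm
  rw [hLs, hKx] at h3
  exact reebMk_eq_iff.2 ⟨f x, h3⟩

end Smoothing

/-! ### The interleaving distance is at most the functional distortion distance -/

section Interleaving

variable {X : Type u} {Y : Type v} [TopologicalSpace X] [TopologicalSpace Y]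
  {f : C(X, ℝ)} {g : C(Y, ℝ)} {ε : ℝ≥0}

/-- A continuous map that changes function values by at most `ε`, turned into a function-preserving
map into the smoothing, `x ↦ [φ x, f x - g (φ x)]`. -/
def shiftMap (φ : C(X, Y)) (h : ∀ x, f x - g (φ x) ∈ Icc (-(ε : ℝ)) (ε : ℝ)) :
    FunMap f (smoothFun g ε) where
  toMap := (reebMk (thickFun g ε)).comp ⟨fun x ↦ (φ x, ⟨f x - g (φ x), h x⟩), by fun_prop⟩
  comm x := add_sub_cancel (g (φ x)) (f x)

theorem sub_mem_Icc_of_supDist_le {φ : C(X, Y)} (h : supDist f (g.comp φ) ≤ ε) (x : X) :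
    f x - g (φ x) ∈ Icc (-(ε : ℝ)) (ε : ℝ) := by
  have h1 : ENNReal.ofReal |f x - g (φ x)| ≤ ε :=
    (le_iSup (fun x ↦ ENNReal.ofReal |f x - (g.comp φ) x|) x).trans h
  rw [← ENNReal.ofReal_coe_nnreal, ENNReal.ofReal_le_ofReal_iff ε.coe_nonneg] at h1
  exact abs_le.1 h1

theorem absDiff_div_two_le_distortion (f : C(X, ℝ)) (g : C(Y, ℝ)) {φ : C(X, Y)} {ψ : C(Y, X)}
    {p q : X × Y} (hp : p ∈ corr φ ψ) (hq : q ∈ corr φ ψ) :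
    absDiff (pathDist f p.1 q.1) (pathDist g p.2 q.2) / 2 ≤ distortion f g φ ψ :=
  le_iSup₂_of_le p hp (le_iSup₂_of_le q hq le_rfl)

theorem distortion_swap (f : C(X, ℝ)) (g : C(Y, ℝ)) (φ : C(X, Y)) (ψ : C(Y, X)) :
    distortion g f ψ φ ≤ distortion f g φ ψ := by
  refine iSup₂_le fun p hp ↦ iSup₂_le fun q hq ↦ ?_
  have hs : ∀ r ∈ corr ψ φ, r.swap ∈ corr φ ψ := fun r hr ↦ hr.symm.imp Eq.symm Eq.symm
  refine le_trans (le_of_eq ?_) (absDiff_div_two_le_distortion f g (hs p hp) (hs q hq))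
  simp only [absDiff, Prod.fst_swap, Prod.snd_swap, max_comm]

theorem shiftMap_smooth_comp_shiftMap {φ : C(X, Y)} {ψ : C(Y, X)}
    (hφ : ∀ x, f x - g (φ x) ∈ Icc (-(ε : ℝ)) (ε : ℝ))
    (hψ : ∀ y, g y - f (ψ y) ∈ Icc (-(ε : ℝ)) (ε : ℝ)) (hD : distortion f g φ ψ < ε) :
    ((shiftMap ψ hψ).smooth ε).comp (shiftMap φ hφ) =
      (smoothIncl (smoothFun f ε) ε).comp (smoothIncl f ε) := by
  ext x
  have h1 : absDiff (pathDist f x (ψ (φ x))) (pathDist g (φ x) (φ x)) / 2 < ε :=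
    (absDiff_div_two_le_distortion f g (p := (x, φ x)) (q := (ψ (φ x), φ x))
      (Or.inl rfl) (Or.inr rfl)).trans_lt hD
  rw [pathDist_self, absDiff, tsub_zero, zero_tsub, max_eq_left zero_le,
    ENNReal.div_lt_iff (by simp) (by simp)] at h1
  have h2 : pathDist f x (ψ (φ x)) < ((ε * 2 : ℝ≥0) : ℝ≥0∞) := by exact_mod_cast h1
  obtain ⟨a, b, hab, hj⟩ := exists_joinedIn_of_pathDist_lt h2
  push_cast at hab
  have hx : f x ∈ Icc a b := hj.source_mem
  refine reebMk_reebMk_eq ⟨_, hψ (φ x)⟩ ⟨_, hφ x⟩ (hj.mono (preimage_mono ?_)) (by simp)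
  exact Icc_subset_Icc (by linarith [hx.2]) (by linarith [hx.1])

theorem interleavingDist_le_functionalDistortionDist (f : C(X, ℝ)) (g : C(Y, ℝ)) :
    interleavingDist f g ≤ functionalDistortionDist f g := by
  by_contra! hlt
  obtain ⟨ε, hε, hε'⟩ := ENNReal.lt_iff_exists_nnreal_btwn.1 hlt
  obtain ⟨φ, hφ⟩ := iInf_lt_iff.1 hε
  obtain ⟨ψ, hψ⟩ := iInf_lt_iff.1 hφ
  obtain ⟨hD, hs⟩ := max_lt_iff.1 hψ
  obtain ⟨h1, h2⟩ := max_lt_iff.1 hs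
  refine hε'.not_ge (iInf₂_le ε ⟨shiftMap φ (sub_mem_Icc_of_supDist_le h1.le),
    shiftMap ψ (sub_mem_Icc_of_supDist_le h2.le), ?_, ?_⟩)
  · exact shiftMap_smooth_comp_shiftMap _ _ hD
  · exact shiftMap_smooth_comp_shiftMap _ _ ((distortion_swap f g φ ψ).trans_lt hD)

end Interleaving

/-! ### The functional distortion of approximate lifts of an interleaving -/

section ApproxLift

variable {X : Type u} {Y : Type v} [TopologicalSpace X] [TopologicalSpace Y]
  {f : C(X, ℝ)} {g : C(Y, ℝ)} {ε δ : ℝ≥0}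

/-- `Φ : X → Y` is a `δ`-approximate lift of `φ : (X, f) → T_ε(Y, g)` if every `φ x` is within path
distance `δ` of some `[Φ x, t]`. -/
def IsApproxLift (φ : FunMap f (smoothFun g ε)) (δ : ℝ≥0) (Φ : C(X, Y)) : Prop :=
  ∀ x, ∃ t, pathDist (smoothFun g ε) (reebMk (thickFun g ε) (Φ x, t)) (φ.toMap x) ≤ δ

variable {φ : FunMap f (smoothFun g ε)} {ψ : FunMap g (smoothFun f ε)} {Φ : C(X, Y)} {Ψ : C(Y, X)}

theorem IsApproxLift.supDist_le (h : IsApproxLift φ δ Φ) : supDist f (g.comp Φ) ≤ ε + δ := by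
  refine iSup_le fun x ↦ ?_
  obtain ⟨t, ht⟩ := h x
  have h1 := (ofReal_abs_sub_le_pathDist _ _ _).trans ht
  rw [← ENNReal.ofReal_coe_nnreal, ENNReal.ofReal_le_ofReal_iff δ.coe_nonneg, φ.comm] at h1
  have h2 : |g (Φ x) + t - f x| ≤ δ := h1
  rw [← ENNReal.coe_add, ← ENNReal.ofReal_coe_nnreal]
  refine ENNReal.ofReal_le_ofReal ?_
  rw [abs_le] at h2
  push_cast
  rw [ContinuousMap.comp_apply, abs_le]
  constructor <;> linarith [t.2.1, t.2.2]

theorem IsApproxLift.pathDist_le [LocallyPathConnectedSpace Y] (h : IsApproxLift φ δ Φ) (x x' : X) :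
    pathDist g (Φ x) (Φ x') ≤ pathDist f x x' + (2 * ε + 2 * δ) := by
  obtain ⟨t, ht⟩ := h x
  obtain ⟨t', ht'⟩ := h x'
  rw [pathDist_comm] at ht'
  calc pathDist g (Φ x) (Φ x')
      ≤ pathDist (smoothFun g ε) (reebMk (thickFun g ε) (Φ x, t))
          (reebMk (thickFun g ε) (Φ x', t')) + 2 * ε := pathDist_fst_le g (Φ x, t) (Φ x', t')
    _ ≤ δ + (pathDist f x x' + δ) + 2 * ε := by
        gcongr
        exact (pathDist_triangle _ _ (φ.toMap x) _).trans (add_le_add ht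
          ((pathDist_triangle _ _ (φ.toMap x') _).trans (add_le_add φ.pathDist_le ht')))
    _ = pathDist f x x' + (2 * ε + 2 * δ) := by ring

/-- A round trip through approximate lifts of the two maps of an interleaving moves points by at
most `4 * ε`, up to the lifting error: in the double smoothing, it stays close to
`T_ε[ψ] (φ x) = ι (ι x)`, and passing to the double smoothing loses at most `4 * ε`. -/
theorem IsApproxLift.pathDist_comp_le [LocallyPathConnectedSpace X]
    (hφ : IsApproxLift φ δ Φ) (hψ : IsApproxLift ψ δ Ψ)
    (hI : (ψ.smooth ε).comp φ = (smoothIncl (smoothFun f ε) ε).comp (smoothIncl f ε)) (x : X) :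
    pathDist f x (Ψ (Φ x)) ≤ 4 * ε + 2 * δ := by
  obtain ⟨t, ht⟩ := hφ x
  obtain ⟨s, hs⟩ := hψ (Φ x)
  have hx : (ψ.smooth ε).toMap (φ.toMap x) = reebMk (thickFun (smoothFun f ε) ε)
      (reebMk (thickFun f ε) (x, ⟨0, by simp⟩), ⟨0, by simp⟩) :=
    congrArg (fun k : FunMap f (smoothFun (smoothFun f ε) ε) ↦ k.toMap x) hI
  have h1 := pathDist_fst_le f (ε := ε) (x, ⟨0, by simp⟩) (Ψ (Φ x), s)
  have h2 := pathDist_fst_le (smoothFun f ε) (ε := ε)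
    (reebMk (thickFun f ε) (x, ⟨0, by simp⟩), ⟨0, by simp⟩)
    (reebMk (thickFun f ε) (Ψ (Φ x), s), t)
  rw [← hx] at h2
  have h3 : pathDist (smoothFun (smoothFun f ε) ε) ((ψ.smooth ε).toMap (φ.toMap x))
      (reebMk (thickFun (smoothFun f ε) ε) (ψ.toMap (Φ x), t)) ≤ δ := by
    rw [pathDist_comm]
    exact ((ψ.smooth ε).pathDist_le (x := reebMk (thickFun g ε) (Φ x, t))).trans ht
  have h4 : pathDist (smoothFun (smoothFun f ε) ε)
      (reebMk (thickFun (smoothFun f ε) ε) (ψ.toMap (Φ x), t))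
      (reebMk (thickFun (smoothFun f ε) ε) (reebMk (thickFun f ε) (Ψ (Φ x), s), t)) ≤ δ := by
    refine (pathDist_reebMk_prodMk_le _ t _ _).trans ?_
    rwa [pathDist_comm]
  calc pathDist f x (Ψ (Φ x)) ≤ _ := h1
    _ ≤ (δ + δ + 2 * ε) + 2 * ε := by
        gcongr
        refine h2.trans ?_
        gcongr
        exact (pathDist_triangle _ _ _ _).trans (add_le_add h3 h4)
    _ = 4 * ε + 2 * δ := by ring

theorem pathDist_le_of_mem_corr [LocallyPathConnectedSpace X]
    (hφ : IsApproxLift φ δ Φ) (hψ : IsApproxLift ψ δ Ψ)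
    (hI : (ψ.smooth ε).comp φ = (smoothIncl (smoothFun f ε) ε).comp (smoothIncl f ε))
    {p q : X × Y} (hp : p ∈ corr Φ Ψ) (hq : q ∈ corr Φ Ψ) :
    pathDist f p.1 q.1 ≤ pathDist g p.2 q.2 + 2 * (5 * ε + 3 * δ) := by
  have key : ∀ r ∈ corr Φ Ψ, pathDist f r.1 (Ψ r.2) ≤ 4 * ε + 2 * δ := by
    rintro ⟨x, y⟩ (h | h)
    · have h : Φ x = y := h
      subst h
      exact hφ.pathDist_comp_le hψ hI x
    · have h : x = Ψ y := h
      subst h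
      simp
  have hq' := key q hq
  rw [pathDist_comm] at hq'
  calc pathDist f p.1 q.1
      ≤ (4 * ε + 2 * δ) + ((pathDist g p.2 q.2 + (2 * ε + 2 * δ)) + (4 * ε + 2 * δ)) :=
        (pathDist_triangle _ _ (Ψ p.2) _).trans (add_le_add (key p hp)
          ((pathDist_triangle _ _ (Ψ q.2) _).trans (add_le_add (hψ.pathDist_le _ _) hq')))
    _ = pathDist g p.2 q.2 + 2 * (5 * ε + 3 * δ) := by ring

theorem IsInterleaving.distortion_le [LocallyPathConnectedSpace X] [LocallyPathConnectedSpace Y]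
    (hI : IsInterleaving φ ψ) (hφ : IsApproxLift φ δ Φ) (hψ : IsApproxLift ψ δ Ψ) :
    distortion f g Φ Ψ ≤ 5 * ε + 3 * δ := by
  refine iSup₂_le fun p hp ↦ iSup₂_le fun q hq ↦ ENNReal.div_le_of_le_mul' (max_le ?_ ?_)
  · exact tsub_le_iff_left.2 (pathDist_le_of_mem_corr hφ hψ hI.1 hp hq)
  · exact tsub_le_iff_left.2 (pathDist_le_of_mem_corr hψ hφ hI.2 (p := p.swap) (q := q.swap)
      (hp.symm.imp Eq.symm Eq.symm) (hq.symm.imp Eq.symm Eq.symm))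

/-- If function-preserving maps into smoothings have arbitrarily good approximate lifts, the
functional distortion distance is bounded in terms of the interleaving distance. -/
theorem functionalDistortionDist_le_of_exists_isApproxLift
    [LocallyPathConnectedSpace X] [LocallyPathConnectedSpace Y] (f : C(X, ℝ)) (g : C(Y, ℝ))
    (hφ : ∀ (ε : ℝ≥0) (φ : FunMap f (smoothFun g ε)) (δ : ℝ≥0), 0 < δ → ∃ Φ, IsApproxLift φ δ Φ)
    (hψ : ∀ (ε : ℝ≥0) (ψ : FunMap g (smoothFun f ε)) (δ : ℝ≥0), 0 < δ → ∃ Ψ, IsApproxLift ψ δ Ψ) :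
    functionalDistortionDist f g ≤ 5 * interleavingDist f g := by
  simp only [interleavingDist, ENNReal.mul_iInf_of_ne (a := 5) (by simp) (by simp)]
  refine le_iInf₂ fun ε ⟨φ, ψ, hI⟩ ↦ ENNReal.le_of_forall_pos_le_add fun δ hδ _ ↦ ?_
  obtain ⟨Φ, hΦ⟩ := hφ ε φ (δ / 3) (by positivity)
  obtain ⟨Ψ, hΨ⟩ := hψ ε ψ (δ / 3) (by positivity)
  have h3 : (5 * ε + 3 * (δ / 3 : ℝ≥0) : ℝ≥0∞) = 5 * ε + δ := by
    have : 3 * (δ / 3) = δ := mul_div_cancel₀ δ (by norm_num)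
    exact_mod_cast congrArg (fun r : ℝ≥0 ↦ ((5 * ε + r : ℝ≥0) : ℝ≥0∞)) this
  have hle : (ε + (δ / 3 : ℝ≥0) : ℝ≥0∞) ≤ 5 * ε + 3 * (δ / 3 : ℝ≥0) := by
    refine add_le_add ?_ ?_ <;> exact le_mul_of_one_le_left' (by norm_num)
  rw [← h3]
  exact iInf₂_le_of_le Φ Ψ (max_le (hI.distortion_le hΦ hΨ)
    (max_le (hΦ.supDist_le.trans hle) (hΨ.supDist_le.trans hle)))

end ApproxLift

/-! ### Reeb graphs as quotients of their cells -/

namespace ReebGraph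

variable (F : ReebGraph.{u})

/-- The cells of the underlying CW complex, of all dimensions. -/
abbrev Cells : Type u :=
  Σ n : ℕ, RelCWComplex.cell (univ : Set F.carrier) n

/-- The map from the disjoint union of closed balls, one for each cell, given by the characteristic
maps. -/
def cellMap (p : Σ c : F.Cells, closedBall (0 : Fin c.1 → ℝ) 1) : F.carrier :=
  RelCWComplex.map (C := (univ : Set F.carrier)) p.1.1 p.1.2 p.2

theorem isQuotientMap_cellMap : IsQuotientMap F.cellMap := by
  have : Finite F.Cells := CWComplex.finite_cells_of_finite (finite := F.finite)
  have : ∀ c : F.Cells, CompactSpace (closedBall (0 : Fin c.1 → ℝ) 1) := fun c ↦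
    isCompact_iff_compactSpace.1 (isCompact_closedBall _ _)
  have hc : Continuous F.cellMap := continuous_sigma fun c ↦
    (RelCWComplex.continuousOn c.1 c.2).domRestrict
  refine hc.isClosedMap.isQuotientMap hc fun x ↦ ?_
  have hx : x ∈ ⋃ (n : ℕ) (j : RelCWComplex.cell (univ : Set F.carrier) n),
      RelCWComplex.closedCell n j := by
    rw [CWComplex.union]
    exact mem_univ x
  obtain ⟨n, j, s, hs, rfl⟩ := by simpa only [mem_iUnion] using hx
  exact ⟨⟨⟨n, j⟩, ⟨s, hs⟩⟩, rfl⟩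

instance : LocallyPathConnectedSpace F.carrier :=
  have (c : F.Cells) : LocallyPathConnectedSpace (closedBall (0 : Fin c.1 → ℝ) 1) :=
    (convex_closedBall _ _).locallyPathConnectedSpace
  F.isQuotientMap_cellMap.locallyPathConnectedSpace

/-- Continuous maps into a Reeb quotient can be lifted approximately from a Reeb graph: lift the
vertices, then the edges with the given endpoints. -/
theorem exists_approx_lift {Z : Type v} [TopologicalSpace Z] [LocallyPathConnectedSpace Z]
    (h : C(Z, ℝ)) (φ : C(F.carrier, ReebQuot h)) {δ : ℝ} (hδ : 0 < δ) :
    ∃ Φ : C(F.carrier, Z),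
      ∀ x, pathDist (reebFun h) (reebMk h (Φ x)) (φ x) ≤ ENNReal.ofReal δ := by
  let χ (e : RelCWComplex.cell (univ : Set F.carrier) 1) :=
    RelCWComplex.map (C := (univ : Set F.carrier)) 1 e
  choose V hV using fun x ↦ (isQuotientMap_reebMk h).surjective (φ x)
  have hline : ∀ e, ContinuousOn (fun t : ℝ ↦ χ e fun _ ↦ t) (Icc (-1) 1) := fun e ↦
    (RelCWComplex.continuousOn 1 e).comp (by fun_prop) fun t ht ↦ by
      rw [mem_closedBall_zero_iff, pi_norm_const, Real.norm_eq_abs]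
      exact abs_le.2 ht
  choose P hPc hP0 hP1 hPδ using fun e ↦
    exists_approx_lift_path h (φ.continuous.comp_continuousOn (hline e))
      (by norm_num : (-1 : ℝ) < 1) hδ (hV _) (hV _)
  have hconst : ∀ s : Fin 1 → ℝ, (fun _ ↦ s 0) = s := fun s ↦ by
    ext i
    rw [Subsingleton.elim i 0]
  -- the lift of an edge is used on the open edge only, where its parametrization is injective
  classical
  let Φ : F.carrier → Z := fun x ↦
    if hx : ∃ e, x ∈ RelCWComplex.openCell (C := (univ : Set F.carrier)) 1 e then
      P hx.choose ((χ hx.choose).symm x 0) else V x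
  have hΦV : ∀ x, (∀ e, x ∉ RelCWComplex.openCell (C := (univ : Set F.carrier)) 1 e) →
      Φ x = V x := fun x hx ↦ dif_neg (by simpa using hx)
  have hΦ0 : ∀ (j : RelCWComplex.cell (univ : Set F.carrier) 0) (x : F.carrier),
      x ∈ RelCWComplex.closedCell 0 j → Φ x = V x := by
    intro j x hx
    refine hΦV x fun e he ↦ ?_
    rw [RelCWComplex.closedCell_zero_eq_singleton, ← RelCWComplex.openCell_zero_eq_singleton] at hx
    have := RelCWComplex.eq_of_not_disjoint_openCell (not_disjoint_iff.2 ⟨x, hx, he⟩)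
    simp at this
  have hΦ1 : ∀ e, ∀ s ∈ closedBall (0 : Fin 1 → ℝ) 1, Φ (χ e s) = P e (s 0) := by
    intro e s hs
    have hs' : |s 0| ≤ 1 := by
      rw [← hconst s, mem_closedBall_zero_iff, pi_norm_const, Real.norm_eq_abs] at hs
      exact hs
    rcases hs'.lt_or_eq with hlt | heq
    · have hsb : s ∈ ball (0 : Fin 1 → ℝ) 1 := by
        rw [← hconst s, mem_ball_zero_iff, pi_norm_const, Real.norm_eq_abs]
        exact hlt
      have hx : ∃ e', χ e s ∈ RelCWComplex.openCell (C := (univ : Set F.carrier)) 1 e' :=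
        ⟨e, s, hsb, rfl⟩
      have hee : hx.choose = e := by
        have := RelCWComplex.eq_of_not_disjoint_openCell
          (not_disjoint_iff.2 ⟨χ e s, hx.choose_spec, ⟨s, hsb, rfl⟩⟩)
        simpa using this
      have hinv : (χ e).symm (χ e s) = s :=
        (χ e).left_inv (by simp only [χ]; rw [RelCWComplex.source_eq]; exact hsb)
      simp only [Φ]
      rw [dif_pos hx, hee, hinv]
    · have hfr : χ e s ∈ RelCWComplex.cellFrontier (C := (univ : Set F.carrier)) 1 e := by
        refine ⟨s, ?_, rfl⟩
        rw [← hconst s, mem_sphere_zero_iff_norm, pi_norm_const, Real.norm_eq_abs]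
        exact heq
      obtain ⟨a, b, hab⟩ := CWComplex.exists_cellFrontier_one_eq e
      have hval : Φ (χ e s) = V (χ e s) := by
        rw [hab] at hfr
        rcases hfr with hfr | hfr
        · exact hΦ0 a _ hfr
        · exact hΦ0 b _ hfr
      rw [hval]
      rcases eq_or_eq_neg_of_abs_eq heq with h1 | h1
      · rw [h1, hP1, ← h1]
        simp only [hconst]
      · rw [h1, hP0, ← h1]
        simp only [hconst]
  have hcont : Continuous Φ := by
    rw [F.isQuotientMap_cellMap.continuous_iff]
    refine continuous_sigma fun ⟨n, c⟩ ↦ ?_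
    match n, c with
    | 0, c =>
      have : Subsingleton (closedBall (0 : Fin 0 → ℝ) 1) := inferInstance
      exact continuous_of_const fun s t ↦
        congrArg (fun r ↦ Φ (F.cellMap ⟨⟨0, c⟩, r⟩)) (this.elim s t)
    | 1, c =>
      have : Continuous fun s : closedBall (0 : Fin 1 → ℝ) 1 ↦ P c (s.1 0) :=
        (hPc c).comp ((continuous_apply 0).comp continuous_subtype_val)
      exact this.congr fun s ↦ (hΦ1 c s.1 s.2).symm
    | n + 2, c => exact ((F.dim_le_one (n + 2) (by omega)).false c).elim
  refine ⟨⟨Φ, hcont⟩, fun x ↦ ?_⟩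
  by_cases hx : ∃ e, x ∈ RelCWComplex.openCell (C := (univ : Set F.carrier)) 1 e
  · obtain ⟨e, s, hs, rfl⟩ := hx
    have hs' := ball_subset_closedBall hs
    have h1 := hPδ e (s 0) (by
      rw [← hconst s, mem_closedBall_zero_iff, pi_norm_const, Real.norm_eq_abs] at hs'
      exact abs_le.1 hs')
    rw [← hΦ1 e s hs'] at h1
    simp only [Function.comp_apply, hconst] at h1
    exact h1
  · change pathDist (reebFun h) (reebMk h (Φ x)) (φ x) ≤ _
    rw [hΦV x (by simpa using hx), hV, pathDist_self]
    exact zero_le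

theorem exists_isApproxLift {Y : Type v} [TopologicalSpace Y] [LocallyPathConnectedSpace Y]
    {g : C(Y, ℝ)} (ε : ℝ≥0) (φ : FunMap F.f (smoothFun g ε)) (δ : ℝ≥0) (hδ : 0 < δ) :
    ∃ Φ, IsApproxLift φ δ Φ := by
  obtain ⟨Φ, hΦ⟩ := F.exists_approx_lift (thickFun g ε) φ.toMap (NNReal.coe_pos.2 hδ)
  refine ⟨ContinuousMap.fst.comp Φ, fun x ↦ ⟨(Φ x).2, ?_⟩⟩
  simpa using hΦ x

end ReebGraph

end ReebDist

theorem mainTheorem1 (F : ReebDist.ReebGraph.{u}) (G : ReebDist.ReebGraph.{v}) :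
    ReebDist.interleavingDist F.f G.f ≤ ReebDist.functionalDistortionDist F.f G.f ∧
      ReebDist.functionalDistortionDist F.f G.f ≤ 7 * ReebDist.interleavingDist F.f G.f := by
  refine ⟨ReebDist.interleavingDist_le_functionalDistortionDist F.f G.f, ?_⟩
  refine (ReebDist.functionalDistortionDist_le_of_exists_isApproxLift F.f G.f
    F.exists_isApproxLift G.exists_isApproxLift).trans ?_
  gcongr
  norm_num
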